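/- Let $\mathbb{A}$ be a unital $*$-algebra over $\mathbb{C}$ (with a topology). Regard $\mathbb{A}^2$ as a right $\mathbb{A}$-module and write $[(u,v)]=(u,v)\mathbb{A}$. Let $\mathcal{S}=\mathbb{A}\mathbb{P}^1$ be the set of all right submodules $x\subset\mathbb{A}^2$ such that $x\cong\mathbb{A}$ and $\mathbb{A}^2=x\oplus x'$ for some right submodule $x'\cong\mathbb{A}$. Give $\mathcal{S}$ the topology defined by its affine charts: $O\subset\mathcal{S}$ is open iff $\{z\in\mathbb{A} : g[(1,z)]\in O\}$ is open in $\mathbb{A}$ for every $g\in \mathrm{GL}(2,\mathbb{A})$; subsets of $\mathcal{S}$ carry the subspace topology. For a submodule $x$ let $x^\perp$ be its orthogonal complement with respect to $\langle u,v\rangle=u_1^*v_1+u_2^*v_2$, and let $J(u_1,u_2)=(u_2,-u_1)$. Write $x\top a$ if $\mathbb{A}^2=x\oplus a$, and put $N=[(i,1)]$, $S=[(-i,1)]$. Define $$\mathcal{R}=\{x\in\mathcal{S}: x^\perp=Jx\},\qquad \mathcal{R}'=\{x\in\mathcal{R}: \mathbb{A}^2=x\oplus x^\perp\},\qquad \mathcal{R}_{N,S}=\{x\in\mathcal{R}: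 x\top N,\ x\top S\}.$$ **Theorem.** (1) If $\mathbb{A}$ is a finite-dimensional $C^*$-algebra, then $\mathcal{R}_{N,S}$ is a connected component of the topological space $\mathcal{R}$. (2) If $\mathbb{A}=M(n,n;\mathbb{C})$ (with $a^*=\overline{a}^{\,t}$ and the usual topology), then $\mathcal{R}=\mathcal{R}'=\mathcal{R}_{N,S}$, and this space is the unitary group $\mathrm{U}(n)$ in the following sense: it is non-empty, and for every choice of an origin $y\in\mathcal{R}_{N,S}$ the set $\mathcal{R}_{N,S}$ is closed under the product $$x\cdot_y z=(P_x^N-P_S^z)(y),$$ where $P_x^N$ is the projector with image $x$ and kernel $N$ and $P_S^z$ the projector with image $S$ and kernel $z$, and there is a homeomorphism $\Phi:\mathcal{R}_{N,S}\to\mathrm{U}(n)$ with $\Phi(x\cdot_y z)=\Phi(x)\Phi(z)$ for all $x,z\in\mathcal{R}_{N,S}$. -/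

import Mathlib

open scoped MulOpposite

noncomputable section

namespace HermProj

section Algebraic

variable (A : Type*) [Ring A]

/-- `A²`, a right `A`-module: right modules over `A` are modules over `Aᵐᵒᵖ`. Its submodules. -/
abbrev RSub := Submodule Aᵐᵒᵖ (A × A)

variable {A}

/-- The right submodule `[(u, v)] = (u, v)A` of `A²`. -/
def pt (u v : A) : RSub A := Submodule.span Aᵐᵒᵖ {(u, v)}

theorem mem_pt {u v : A} {w : A × A} : w ∈ pt u v ↔ ∃ a : A, (u * a, v * a) = w := by
  unfold pt
  rw [Submodule.mem_span_singleton]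
  constructor
  · rintro ⟨a, rfl⟩
    exact ⟨a.unop, rfl⟩
  · rintro ⟨a, rfl⟩
    exact ⟨MulOpposite.op a, rfl⟩

/-- `x` belongs to the projective line `AP¹`, the Grassmannian of type and co-type `A` in `A²`:
`x ≅ A` as a right module, and `x` has a complement that is isomorphic to `A`. -/
def IsProjPoint (x : RSub A) : Prop :=
  Nonempty (x ≃ₗ[Aᵐᵒᵖ] A) ∧ ∃ y : RSub A, IsCompl x y ∧ Nonempty (y ≃ₗ[Aᵐᵒᵖ] A)

variable (A) in
/-- The projective line `𝒮 = AP¹` over `A`. -/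
def ProjLine := {x : RSub A // IsProjPoint x}

/-- Linear automorphisms of the right module `A²`, that is, the group `GL(2, A)`, act on `AP¹`. -/
theorem IsProjPoint.map {x : RSub A} (hx : IsProjPoint x) (g : (A × A) ≃ₗ[Aᵐᵒᵖ] (A × A)) :
    IsProjPoint (x.map (g : (A × A) →ₗ[Aᵐᵒᵖ] (A × A))) := by
  obtain ⟨⟨e⟩, y, hxy, ⟨f⟩⟩ := hx
  refine ⟨⟨(g.submoduleMap x).symm.trans e⟩, y.map (g : (A × A) →ₗ[Aᵐᵒᵖ] (A × A)), ?_,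
    ⟨(g.submoduleMap y).symm.trans f⟩⟩
  exact hxy.map (Submodule.orderIsoMapComap g)

theorem isProjPoint_affine (z : A) : IsProjPoint (pt 1 z) := by
  refine ⟨⟨?_⟩, pt 0 1, ?_, ⟨?_⟩⟩
  · exact
      { toFun := fun w => w.1.1
        map_add' := fun _ _ => rfl
        map_smul' := fun _ _ => rfl
        invFun := fun a => ⟨(1 * a, z * a), mem_pt.2 ⟨a, rfl⟩⟩
        left_inv := by
          rintro ⟨w, hw⟩
          obtain ⟨a, rfl⟩ := mem_pt.1 hw
          simp
        right_inv := fun a => one_mul a }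
  · constructor
    · rw [Submodule.disjoint_def]
      intro w h1 h2
      obtain ⟨a, rfl⟩ := mem_pt.1 h1
      obtain ⟨b, hb⟩ := mem_pt.1 h2
      simp only [Prod.mk.injEq, zero_mul, one_mul] at hb
      simp [← hb.1]
    · rw [codisjoint_iff, eq_top_iff]
      rintro ⟨u, v⟩ -
      refine Submodule.mem_sup.2 ⟨(1 * u, z * u), mem_pt.2 ⟨u, rfl⟩,
        (0 * (v - z * u), 1 * (v - z * u)), mem_pt.2 ⟨_, rfl⟩, by simp⟩
  · exact
      { toFun := fun w => w.1.2
        map_add' := fun _ _ => rfl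
        map_smul' := fun _ _ => rfl
        invFun := fun a => ⟨(0 * a, 1 * a), mem_pt.2 ⟨a, rfl⟩⟩
        left_inv := by
          rintro ⟨w, hw⟩
          obtain ⟨a, rfl⟩ := mem_pt.1 hw
          simp
        right_inv := fun a => one_mul a }

/-- The affine chart `A → AP¹`, `z ↦ g[(1, z)]`. Its image is the affine part of all points
transversal to `g[(0, 1)]`, and every affine part arises in this way. -/
def affineChart (g : (A × A) ≃ₗ[Aᵐᵒᵖ] (A × A)) (z : A) : ProjLine A :=
  ⟨(pt 1 z).map (g : (A × A) →ₗ[Aᵐᵒᵖ] (A × A)), (isProjPoint_affine z).map g⟩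

/-- The topology of the projective line: a set is open if and only if its trace in every affine
chart is open. -/
instance ProjLine.instTopologicalSpace [TopologicalSpace A] : TopologicalSpace (ProjLine A) :=
  ⨆ g : (A × A) ≃ₗ[Aᵐᵒᵖ] (A × A), TopologicalSpace.coinduced (affineChart g) inferInstance

variable (A) in
/-- The map `J (u₁, u₂) = (u₂, -u₁)` of `A²`. -/
def mapJ : (A × A) →ₗ[Aᵐᵒᵖ] (A × A) :=
  (LinearMap.snd Aᵐᵒᵖ A A).prod (-(LinearMap.fst Aᵐᵒᵖ A A))

/-- With respect to `W = b ⊕ z = x ⊕ a`, the image of `y` under `P_x^a - P_b^z`, where `P_p^q` is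
the projector with image `p` and kernel `q`. -/
def torsorProd {a b x z : RSub A} (hx : IsCompl x a) (hz : IsCompl z b) (y : RSub A) : RSub A :=
  y.map (x.projection a hx - b.projection z hz.symm)

end Algebraic

section Star

variable {A : Type*} [Ring A] [StarRing A]

/-- The orthogonal complement of `x` with respect to `⟨u, v⟩ = u₁* v₁ + u₂* v₂`. -/
def perp (x : RSub A) : RSub A where
  carrier := {v | ∀ u ∈ x, star u.1 * v.1 + star u.2 * v.2 = 0}
  zero_mem' := by simp
  add_mem' := by
    intro v w hv hw u hu
    have h : star u.1 * (v + w).1 + star u.2 * (v + w).2 =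
        (star u.1 * v.1 + star u.2 * v.2) + (star u.1 * w.1 + star u.2 * w.2) := by
      simp only [Prod.fst_add, Prod.snd_add, mul_add]
      abel
    rw [h, hv u hu, hw u hu, add_zero]
  smul_mem' := by
    intro a v hv u hu
    have h : star u.1 * (a • v).1 + star u.2 * (a • v).2 =
        (star u.1 * v.1 + star u.2 * v.2) * a.unop := by
      simp only [Prod.smul_fst, Prod.smul_snd, MulOpposite.smul_eq_mul_unop, add_mul, mul_assoc]
    rw [h, hv u hu, zero_mul]

variable (A) in
/-- The Hermitian projective line `ℛ`, as a subset of `AP¹`. -/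
def hermitianLine : Set (ProjLine A) :=
  {x | perp x.1 = x.1.map (mapJ A)}

variable (A) in
/-- The space `ℛ'` of all `x ∈ ℛ` with `A² = x ⊕ x^⊥`. -/
def hermitianLine' : Set (ProjLine A) :=
  {x | x ∈ hermitianLine A ∧ IsCompl x.1 (perp x.1)}

variable [Algebra ℂ A]

variable (A) in
/-- The north pole `N = [(i, 1)]`. -/
def northPole : RSub A := pt (algebraMap ℂ A Complex.I) 1

variable (A) in
/-- The south pole `S = [(-i, 1)]`. -/
def southPole : RSub A := pt (-algebraMap ℂ A Complex.I) 1

variable (A) in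
/-- The real unitary universe `ℛ_{N,S}`: the points of `ℛ` that are transversal to `N` and `S`. -/
def realUnitaryUniverse : Set (ProjLine A) :=
  {x | x ∈ hermitianLine A ∧ IsCompl x.1 (northPole A) ∧ IsCompl x.1 (southPole A)}

/-- The product `x ·_y z = (P_x^N - P_S^z)(y)` on `ℛ_{N,S}` with origin `y`, as a submodule. -/
def unitaryProd (y x z : realUnitaryUniverse A) : RSub A :=
  torsorProd x.2.2.1 z.2.2.2 y.1.1

end Star

end HermProj

end

open scoped MulOpposite

noncomputable section

namespace HermProj

/-! ### Generators of points and the torsor product in coordinates -/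

section Points

variable {A : Type*} [Ring A]

/-! The Cayley transform `cayley` carries `[(0, 1)]` to `N` and `[(1, 0)]` to `S`, doubles the
Hermitian form, and turns `J` into `diag(i, -i)`. If `cayley [(q, p)]` lies in `ℛ`, then `q* q = p*
p`. When `t* t = 0` forces `t = 0`, this makes left multiplication by `q` and by `p` injective; in
finite dimension both are then units, and the point is `cayley [(1, w)]` with `w = p q⁻¹` unitary.
Hence `ℛ`, `ℛ'` and `ℛ_{N,S}` are all the image of the unitary group under one affine chart
(`exists_unitary_of_mem_hermitianLine`).

Affine charts are open embeddings (`isOpenEmbedding_affineChart`) when the units are open and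
inversion is continuous on them, and in this chart the torsor product is `u v⁻¹ w`
(`torsorProd_map_pt_one`); this gives (2). For (1), a unitary in a finite-dimensional `C⋆`-algebra
has finite spectrum, so it is an exponential and is joined to `1`: `ℛ` itself is connected. -/

theorem map_pt (g : (A × A) →ₗ[Aᵐᵒᵖ] (A × A)) (u v : A) :
    (pt u v).map g = pt (g (u, v)).1 (g (u, v)).2 := by
  rw [pt, Submodule.map_span, Set.image_singleton]
  rfl

theorem pt_mul_right {c : A} (hc : IsUnit c) (u v : A) : pt (u * c) (v * c) = pt u v := by
  obtain ⟨c, rfl⟩ := hc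
  ext w
  rw [mem_pt, mem_pt]
  constructor
  · rintro ⟨a, rfl⟩
    exact ⟨c * a, by simp [mul_assoc]⟩
  · rintro ⟨a, rfl⟩
    exact ⟨↑c⁻¹ * a, by simp [mul_assoc]⟩

theorem mem_pt_one {z : A} {w : A × A} : w ∈ pt 1 z ↔ w.2 = z * w.1 := by
  rw [mem_pt]
  constructor
  · rintro ⟨a, rfl⟩
    simp
  · intro h
    exact ⟨w.1, by ext <;> simp [h]⟩

theorem mem_pt_zero_one {w : A × A} : w ∈ pt (0 : A) 1 ↔ w.1 = 0 := by
  rw [mem_pt]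
  constructor
  · rintro ⟨a, rfl⟩
    simp
  · intro h
    exact ⟨w.2, by ext <;> simp [h]⟩

theorem pt_one_injective : Function.Injective (pt (1 : A)) := by
  intro z z' h
  have h1 : ((1 : A), z) ∈ pt 1 z' := h ▸ mem_pt_one.2 (by simp)
  simpa using mem_pt_one.1 h1

theorem isCompl_pt_one_pt_zero_one (z : A) : IsCompl (pt 1 z) (pt 0 1) := by
  constructor
  · rw [Submodule.disjoint_def]
    intro w h1 h2
    rw [mem_pt_one] at h1
    rw [mem_pt_zero_one] at h2
    ext <;> simp [h1, h2]
  · rw [codisjoint_iff, eq_top_iff]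
    rintro ⟨u, v⟩ -
    exact Submodule.mem_sup.2 ⟨(u, z * u), mem_pt_one.2 rfl, (0, v - z * u),
      mem_pt_zero_one.2 rfl, by simp⟩

theorem isCompl_pt_one_pt_one {z z' : A} (h : IsUnit (z - z')) : IsCompl (pt 1 z) (pt 1 z') := by
  constructor
  · rw [Submodule.disjoint_def]
    intro w h1 h2
    rw [mem_pt_one] at h1 h2
    have h3 : w.1 = 0 := by
      apply h.mul_right_eq_zero.1
      rw [sub_mul, ← h1, ← h2, sub_self]
    ext <;> simp [h1, h3]
  · rw [codisjoint_iff, eq_top_iff]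
    rintro ⟨u, v⟩ -
    obtain ⟨d, hd⟩ := h
    refine Submodule.mem_sup.2 ⟨(↑d⁻¹ * (v - z' * u), z * (↑d⁻¹ * (v - z' * u))),
      mem_pt_one.2 rfl, (u - ↑d⁻¹ * (v - z' * u), z' * (u - ↑d⁻¹ * (v - z' * u))),
      mem_pt_one.2 rfl, ?_⟩
    have hz : z = d + z' := by rw [hd]; abel
    ext
    · simp
    · simp only [Prod.mk_add_mk, hz, add_mul, mul_sub, Units.mul_inv_cancel_left]
      abel

theorem isCompl_map (g : (A × A) ≃ₗ[Aᵐᵒᵖ] (A × A)) {x y : RSub A} (h : IsCompl x y) :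
    IsCompl (x.map (g : (A × A) →ₗ[Aᵐᵒᵖ] (A × A))) (y.map (g : (A × A) →ₗ[Aᵐᵒᵖ] (A × A))) :=
  h.map (Submodule.orderIsoMapComap g)

theorem affineChart_injective (g : (A × A) ≃ₗ[Aᵐᵒᵖ] (A × A)) :
    Function.Injective (affineChart g) := fun _ _ h =>
  pt_one_injective (Submodule.map_injective_of_injective g.injective (congrArg Subtype.val h))

/-- A point of the projective line is generated by a single vector, whose annihilator is zero. -/
theorem IsProjPoint.exists_eq_pt {x : RSub A} (hx : IsProjPoint x) :
    ∃ u v : A, x = pt u v ∧ ∀ t : A, u * t = 0 → v * t = 0 → t = 0 := by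
  obtain ⟨⟨e⟩, -⟩ := hx
  have key : ∀ t : A, ((e.symm t : x) : A × A) =
      (((e.symm 1 : x) : A × A).1 * t, ((e.symm 1 : x) : A × A).2 * t) := by
    intro t
    have : e.symm t = MulOpposite.op t • e.symm 1 := by
      rw [← map_smul]
      simp
    rw [this]
    ext <;> simp
  refine ⟨((e.symm 1 : x) : A × A).1, ((e.symm 1 : x) : A × A).2, ?_, ?_⟩
  · ext w
    rw [mem_pt]
    constructor
    · intro hw
      refine ⟨e ⟨w, hw⟩, ?_⟩
      rw [← key]
      simp
    · rintro ⟨a, rfl⟩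
      rw [← key]
      exact (e.symm a).2
  · intro t h1 h2
    have h := key t
    rw [h1, h2] at h
    exact e.symm.map_eq_zero_iff.1 (Subtype.ext h)

/-- In the affine chart of the points transversal to `a = g[(0, 1)]`, with `b = g[(1, 0)]`,
the torsor product is `(X, Y, Z) ↦ X Y⁻¹ Z`. -/
theorem torsorProd_map_pt_one (g : (A × A) ≃ₗ[Aᵐᵒᵖ] (A × A)) (X Y Z : Aˣ) {a b x y z : RSub A}
    (ha : a = (pt 0 1).map (g : (A × A) →ₗ[Aᵐᵒᵖ] (A × A)))
    (hb : b = (pt 1 0).map (g : (A × A) →ₗ[Aᵐᵒᵖ] (A × A)))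
    (hX : x = (pt 1 (X : A)).map (g : (A × A) →ₗ[Aᵐᵒᵖ] (A × A)))
    (hY : y = (pt 1 (Y : A)).map (g : (A × A) →ₗ[Aᵐᵒᵖ] (A × A)))
    (hZ : z = (pt 1 (Z : A)).map (g : (A × A) →ₗ[Aᵐᵒᵖ] (A × A)))
    (hx : IsCompl x a) (hz : IsCompl z b) :
    torsorProd hx hz y =
      (pt 1 (↑(X * Y⁻¹ * Z) : A)).map (g : (A × A) →ₗ[Aᵐᵒᵖ] (A × A)) := by
  -- The generator `(1, Y)` of `y` splits along `x ⊕ a` as `(1, X) + (0, Y - X)`.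
  have hP : x.projection a hx (g (1, (Y : A))) = g (1, (X : A)) := by
    have h1 : g (1, (X : A)) ∈ x := by
      rw [hX]; exact Submodule.mem_map_of_mem (mem_pt_one.2 (by simp))
    have h2 : g (0, (Y : A) - X) ∈ a := by
      rw [ha]; exact Submodule.mem_map_of_mem (mem_pt_zero_one.2 rfl)
    have h3 : g (1, (Y : A)) = g (1, (X : A)) + g (0, (Y : A) - X) := by
      rw [← map_add]; simp
    rw [h3, map_add, Submodule.projection_apply_of_mem_left hx h1,
      Submodule.projection_apply_of_mem_right hx h2, add_zero]
  -- Along `b ⊕ z` it splits as `(1 - Z⁻¹Y, 0) + (1, Z) Z⁻¹Y`.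
  have hQ : b.projection z hz.symm (g (1, (Y : A))) = g (1 - ↑(Z⁻¹ * Y), 0) := by
    have h1 : g (1 - (↑(Z⁻¹ * Y) : A), 0) ∈ b := by
      rw [hb]; exact Submodule.mem_map_of_mem (mem_pt_one.2 (by simp))
    have h2 : g ((↑(Z⁻¹ * Y) : A), (Y : A)) ∈ z := by
      rw [hZ]; exact Submodule.mem_map_of_mem (mem_pt_one.2 (by simp))
    have h3 : g (1, (Y : A)) =
        g (1 - (↑(Z⁻¹ * Y) : A), 0) + g ((↑(Z⁻¹ * Y) : A), (Y : A)) := by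
      rw [← map_add]; simp
    rw [h3, map_add, Submodule.projection_apply_of_mem_left hz.symm h1,
      Submodule.projection_apply_of_mem_right hz.symm h2, add_zero]
  have hc : IsUnit (↑(Z⁻¹ * Y) : A) := Units.isUnit _
  -- The difference is `(Z⁻¹Y, X) = (1, X Y⁻¹ Z) Z⁻¹Y`, so the unit `Z⁻¹Y` can be dropped from the
  -- generator.
  have hd : (x.projection a hx - b.projection z hz.symm) (g (1, (Y : A))) =
      g (1 * (↑(Z⁻¹ * Y) : A), (↑(X * Y⁻¹ * Z) : A) * (↑(Z⁻¹ * Y) : A)) := by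
    rw [LinearMap.sub_apply, hP, hQ, ← map_sub, ← Units.val_mul]
    congr 1
    ext
    · simp
    · simp [mul_assoc]
  rw [torsorProd, hY, ← Submodule.map_comp, map_pt, ← pt_mul_right hc 1, map_pt]
  simp only [LinearMap.comp_apply, LinearEquiv.coe_coe]
  rw [hd]

end Points

/-! ### Affine charts as open embeddings -/

section Charts

variable {A : Type*} [Ring A]

/-- The transition between two affine charts. -/
theorem map_pt_one_eq_map_pt_one_iff (g h : (A × A) ≃ₗ[Aᵐᵒᵖ] (A × A)) (z o : A) :
    (pt 1 o).map (g : (A × A) →ₗ[Aᵐᵒᵖ] (A × A)) = (pt 1 z).map (h : (A × A) →ₗ[Aᵐᵒᵖ] (A × A)) ↔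
      IsUnit (g.symm (h (1, z))).1 ∧
        o = (g.symm (h (1, z))).2 * Ring.inverse (g.symm (h (1, z))).1 := by
  obtain ⟨⟨a, b⟩, hk⟩ : ∃ w, w = g.symm (h (1, z)) := ⟨_, rfl⟩
  have hk' : h (1, z) = g (a, b) := by rw [hk, g.apply_symm_apply]
  rw [← hk, map_pt (h : (A × A) →ₗ[Aᵐᵒᵖ] (A × A)), LinearEquiv.coe_coe, hk', ← LinearEquiv.coe_coe,
    ← map_pt]
  constructor
  · intro heq
    replace heq := Submodule.map_injective_of_injective g.injective heq
    have h1 : ((1 : A), o) ∈ pt a b := heq ▸ mem_pt_one.2 (by simp)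
    have h2 : (a, b) ∈ pt 1 o := heq ▸ mem_pt.2 ⟨1, by simp⟩
    obtain ⟨c, hc⟩ := mem_pt.1 h1
    rw [mem_pt_one] at h2
    simp only [Prod.mk.injEq] at hc h2
    -- A right inverse need not be a left inverse in `A`. Here `(a, b)` is fixed by `c * a`, hence
    -- so is `(1, z)` by injectivity of `h`.
    have hca : c * a = 1 := by
      have h3 : h (1 * (c * a), z * (c * a)) = h (1, z) := by
        have e1 : ((1 * (c * a), z * (c * a)) : A × A) = MulOpposite.op (c * a) • ((1 : A), z) := by
          ext <;> simp
        have e2 : ((a, b) : A × A) = MulOpposite.op (c * a) • (a, b) := by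
          ext
          · simp [← mul_assoc, hc.1]
          · change b = b * (c * a)
            rw [← mul_assoc, hc.2, h2]
        rw [e1, map_smul, hk', ← map_smul, ← e2]
      simpa using congrArg Prod.fst (h.injective h3)
    have hu : IsUnit a := ⟨⟨a, c, hc.1, hca⟩, rfl⟩
    refine ⟨hu, ?_⟩
    rw [h2, mul_assoc, Ring.mul_inverse_cancel _ hu, mul_one]
  · rintro ⟨hu, ho⟩
    simp only at hu ho
    rw [← pt_mul_right hu 1 o, ho, one_mul, mul_assoc, Ring.inverse_mul_cancel _ hu, mul_one]

variable [TopologicalSpace A]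

theorem continuous_affineChart (g : (A × A) ≃ₗ[Aᵐᵒᵖ] (A × A)) : Continuous (affineChart g) :=
  continuous_iSup_rng (i := g) continuous_coinduced_rng

theorem continuous_apply_one [IsTopologicalRing A] (k : (A × A) →ₗ[Aᵐᵒᵖ] (A × A)) :
    Continuous fun z : A => k (1, z) := by
  have h : ∀ z : A, k (1, z) = k (1, 0) + ((k (0, 1)).1 * z, (k (0, 1)).2 * z) := by
    intro z
    have e : ((1 : A), z) = (1, 0) + MulOpposite.op z • ((0 : A), (1 : A)) := by
      ext <;> simp
    rw [e, map_add, map_smul]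
    congr 1
  rw [funext h]
  fun_prop

/-- In the final topology, the image of an open set must be tested in every chart `h`. Its trace
there is a preimage under the transition map, which is continuous on an open domain. -/
theorem isOpenEmbedding_affineChart [IsTopologicalRing A] (hU : IsOpen {a : A | IsUnit a})
    (hI : ContinuousOn Ring.inverse {a : A | IsUnit a}) (g : (A × A) ≃ₗ[Aᵐᵒᵖ] (A × A)) :
    Topology.IsOpenEmbedding (affineChart g) := by
  refine .of_continuous_injective_isOpenMap (continuous_affineChart g)
    (affineChart_injective g) ?_
  intro O hO
  refine isOpen_iSup_iff.2 fun h => isOpen_coinduced.2 ?_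
  have hc := continuous_apply_one (h.trans g.symm : (A × A) ≃ₗ[Aᵐᵒᵖ] (A × A)).toLinearMap
  have hV : IsOpen {z : A | IsUnit (g.symm (h (1, z))).1} := hU.preimage (continuous_fst.comp hc)
  have hf : ContinuousOn
      (fun z : A => (g.symm (h (1, z))).2 * Ring.inverse (g.symm (h (1, z))).1)
      {z : A | IsUnit (g.symm (h (1, z))).1} :=
    (continuous_snd.comp hc).continuousOn.mul
      (hI.comp (continuous_fst.comp hc).continuousOn fun _ hz => hz)
  convert hf.isOpen_inter_preimage hV hO using 1
  ext z
  simp only [Set.mem_preimage, Set.mem_image, Set.mem_inter_iff, Set.mem_ofPred_eq]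
  constructor
  · rintro ⟨o, ho, heq⟩
    obtain ⟨h1, h2⟩ := (map_pt_one_eq_map_pt_one_iff g h z o).1 (congrArg Subtype.val heq)
    exact ⟨h1, h2 ▸ ho⟩
  · rintro ⟨h1, h2⟩
    exact ⟨_, h2, Subtype.ext ((map_pt_one_eq_map_pt_one_iff g h z _).2 ⟨h1, rfl⟩)⟩

end Charts

/-! ### The Cayley transform -/

section Cayley

variable {A : Type*} [Ring A] [Algebra ℂ A]

theorem I_smul_I_smul (a : A) : Complex.I • Complex.I • a = -a := by
  rw [smul_smul, Complex.I_mul_I, neg_one_smul]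

variable (A) in
/-- The Cayley transform `(q, p) ↦ (q + p, i (q - p))`. It maps `[(0, 1)]` to the north pole,
`[(1, 0)]` to the south pole, and the unitary group onto the Hermitian projective line. -/
def cayley : (A × A) ≃ₗ[Aᵐᵒᵖ] (A × A) where
  toFun w := (w.1 + w.2, Complex.I • (w.1 - w.2))
  map_add' v w := by
    ext
    · simp only [Prod.fst_add, Prod.snd_add]; abel
    · simp only [Prod.fst_add, Prod.snd_add, ← smul_add]; congr 1; abel
  map_smul' a w := by
    ext
    · simp
    · simp only [Prod.smul_fst, Prod.smul_snd, RingHom.id_apply, ← smul_sub]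
      rw [smul_comm]
  invFun w := ((1 / 2 : ℂ) • (w.1 - Complex.I • w.2), (1 / 2 : ℂ) • (w.1 + Complex.I • w.2))
  left_inv w := by
    ext
    · simp only [I_smul_I_smul]; module
    · simp only [I_smul_I_smul]; module
  right_inv w := by
    ext
    · module
    · simp only [← smul_sub]
      rw [smul_comm]
      have : w.1 - Complex.I • w.2 - (w.1 + Complex.I • w.2) = -((2 : ℂ) • Complex.I • w.2) := by
        module
      rw [this, smul_neg, smul_comm Complex.I (2 : ℂ), I_smul_I_smul]
      module

theorem cayley_apply (w : A × A) : cayley A w = (w.1 + w.2, Complex.I • (w.1 - w.2)) := rfl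

theorem isUnit_algebraMap {c : ℂ} (hc : c ≠ 0) : IsUnit (algebraMap ℂ A c) :=
  (IsUnit.mk0 c hc).map _

theorem northPole_eq : northPole A = (pt 0 1).map (cayley A : (A × A) →ₗ[Aᵐᵒᵖ] (A × A)) := by
  -- `cayley (0, 1) = (1, -i) = (i, 1)(-i)`.
  rw [map_pt, northPole,
    ← pt_mul_right (isUnit_algebraMap (A := A) (c := -Complex.I) (by simp))]
  congr 1
  · simp [cayley_apply, ← map_mul]
  · simp [cayley_apply, Algebra.smul_def]

theorem southPole_eq : southPole A = (pt 1 0).map (cayley A : (A × A) →ₗ[Aᵐᵒᵖ] (A × A)) := by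
  rw [map_pt, southPole,
    ← pt_mul_right (isUnit_algebraMap (A := A) (c := Complex.I) (by simp))]
  congr 1
  · simp [cayley_apply, ← map_mul]
  · simp [cayley_apply, Algebra.smul_def]

theorem mapJ_cayley (w : A × A) :
    mapJ A (cayley A w) = cayley A (Complex.I • w.1, -(Complex.I • w.2)) := by
  have h : mapJ A (cayley A w) = (Complex.I • (w.1 - w.2), -(w.1 + w.2)) := rfl
  rw [h, cayley_apply]
  ext
  · simp only; module
  · simp only [sub_neg_eq_add, smul_add, I_smul_I_smul]; abel

/-- Up to the central unit `i`, which does not change the submodule, `diag(i, -i)` is `diag(1, -1)`.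
-/
theorem map_mapJ_map_cayley_pt (u v : A) :
    ((pt u v).map (cayley A : (A × A) →ₗ[Aᵐᵒᵖ] (A × A))).map (mapJ A) =
      (pt u (-v)).map (cayley A : (A × A) →ₗ[Aᵐᵒᵖ] (A × A)) := by
  have h : cayley A (u * algebraMap ℂ A Complex.I, -v * algebraMap ℂ A Complex.I) =
      mapJ A (cayley A (u, v)) := by
    rw [mapJ_cayley]
    simp [Algebra.smul_def, Algebra.commutes]
  rw [← pt_mul_right (isUnit_algebraMap (A := A) Complex.I_ne_zero) u (-v), map_pt, map_pt, map_pt]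
  simp only [LinearEquiv.coe_coe, h, Prod.mk.eta]

/-- An injective endomorphism of a finite-dimensional space is surjective, which yields a right
inverse; injectivity then makes it two-sided. -/
theorem isUnit_of_mul_right_cancel_zero [FiniteDimensional ℂ A] {p : A}
    (h : ∀ t : A, p * t = 0 → t = 0) : IsUnit p := by
  have hi : Function.Injective (LinearMap.mulLeft ℂ p) :=
    (injective_iff_map_eq_zero _).2 h
  obtain ⟨c, hc⟩ := LinearMap.injective_iff_surjective.1 hi 1
  have hc : p * c = 1 := hc
  refine ⟨⟨p, c, hc, hi ?_⟩, rfl⟩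
  simp [← mul_assoc, hc]

/-! ### Hermitian points and unitary elements -/

section Star

variable [StarRing A] [StarModule ℂ A]

/-- The Cayley transform is a similitude. -/
theorem inner_cayley (v w : A × A) :
    star (cayley A v).1 * (cayley A w).1 + star (cayley A v).2 * (cayley A w).2 =
      (2 : ℂ) • (star v.1 * w.1 + star v.2 * w.2) := by
  simp only [cayley_apply, star_smul, star_add, star_sub, smul_mul_smul_comm, RCLike.star_def,
    Complex.conj_I, neg_mul, Complex.I_mul_I, neg_neg, one_smul, two_smul]
  noncomm_ring

theorem perp_map_cayley (y : RSub A) :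
    perp (y.map (cayley A : (A × A) →ₗ[Aᵐᵒᵖ] (A × A))) =
      (perp y).map (cayley A : (A × A) →ₗ[Aᵐᵒᵖ] (A × A)) := by
  ext w
  obtain ⟨w, rfl⟩ := (cayley A).surjective w
  have h1 : cayley A w ∈ (perp y).map (cayley A : (A × A) →ₗ[Aᵐᵒᵖ] (A × A)) ↔ w ∈ perp y :=
    (cayley A).injective.mem_set_image
  rw [h1]
  constructor
  · intro h u hu
    have h2 := h (cayley A u) (Submodule.mem_map_of_mem hu)
    rw [inner_cayley] at h2
    exact (smul_eq_zero_iff_right two_ne_zero).1 h2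
  · rintro h _ ⟨u, hu, rfl⟩
    rw [LinearEquiv.coe_coe, inner_cayley, h u hu, smul_zero]

/-- The points of the affine chart given by a unitary element are Hermitian. -/
theorem perp_map_cayley_pt_one {w : A} (hw : w ∈ unitary A) :
    perp ((pt 1 w).map (cayley A : (A × A) →ₗ[Aᵐᵒᵖ] (A × A))) =
      (pt 1 (-w)).map (cayley A : (A × A) →ₗ[Aᵐᵒᵖ] (A × A)) := by
  rw [perp_map_cayley]
  congr 1
  ext v
  rw [mem_pt_one]
  constructor
  · intro h
    have h1 : v.1 + star w * v.2 = 0 := by simpa using h (1, w) (mem_pt_one.2 (by simp))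
    rw [eq_neg_of_add_eq_zero_left h1, neg_mul_neg, ← mul_assoc, Unitary.mul_star_self_of_mem hw,
      one_mul]
  · intro h u hu
    rw [mem_pt_one] at hu
    rw [hu, h, star_mul, neg_mul, mul_neg, mul_assoc, ← mul_assoc (star w),
      Unitary.star_mul_self_of_mem hw, one_mul, add_neg_cancel]

theorem affineChart_cayley_mem_hermitianLine {w : A} (hw : w ∈ unitary A) :
    affineChart (cayley A) w ∈ hermitianLine A :=
  (perp_map_cayley_pt_one hw).trans (map_mapJ_map_cayley_pt 1 w).symm

theorem affineChart_cayley_mem_hermitianLine' {w : A} (hw : w ∈ unitary A) :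
    affineChart (cayley A) w ∈ hermitianLine' A := by
  refine ⟨affineChart_cayley_mem_hermitianLine hw, ?_⟩
  have h := perp_map_cayley_pt_one hw
  change IsCompl ((pt 1 w).map _) (perp ((pt 1 w).map _))
  rw [h]
  refine isCompl_map _ (isCompl_pt_one_pt_one ?_)
  have h2 : w - -w = algebraMap ℂ A 2 * w := by
    rw [← Algebra.smul_def, two_smul, sub_neg_eq_add]
  rw [h2]
  exact (isUnit_algebraMap two_ne_zero).mul (Unitary.toUnits ⟨w, hw⟩).isUnit

theorem affineChart_cayley_mem_realUnitaryUniverse {w : A} (hw : w ∈ unitary A) :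
    affineChart (cayley A) w ∈ realUnitaryUniverse A := by
  refine ⟨affineChart_cayley_mem_hermitianLine hw, ?_, ?_⟩
  · rw [northPole_eq]
    exact isCompl_map _ (isCompl_pt_one_pt_zero_one w)
  · rw [southPole_eq]
    refine isCompl_map _ (isCompl_pt_one_pt_one ?_)
    rw [sub_zero]
    exact (Unitary.toUnits ⟨w, hw⟩).isUnit

/-- If `star t * t = 0` only for `t = 0`, and `A` has finite dimension, then every Hermitian point
is the image of a unitary element under the Cayley transform. -/
theorem exists_unitary_of_mem_hermitianLine [FiniteDimensional ℂ A]
    (hA : ∀ t : A, star t * t = 0 → t = 0) {x : ProjLine A} (hx : x ∈ hermitianLine A) :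
    ∃ w ∈ unitary A, affineChart (cayley A) w = x := by
  obtain ⟨u, v, hxuv, huv⟩ := x.2.exists_eq_pt
  obtain ⟨⟨q, p⟩, hqp⟩ := (cayley A).surjective (u, v)
  have hx1 : x.1 = (pt q p).map (cayley A : (A × A) →ₗ[Aᵐᵒᵖ] (A × A)) := by
    rw [hxuv, map_pt, LinearEquiv.coe_coe, hqp]
  have hcancel : ∀ t : A, q * t = 0 → p * t = 0 → t = 0 := by
    intro t h1 h2
    have h3 : cayley A (q * t, p * t) = (u * t, v * t) := by
      have := (cayley A).map_smul (MulOpposite.op t) (q, p)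
      rw [hqp] at this
      exact this
    rw [h1, h2, Prod.mk_zero_zero, map_zero] at h3
    simp only [Prod.zero_eq_mk, Prod.mk.injEq] at h3
    exact huv t h3.1.symm h3.2.symm
  -- Only `Jx ⊆ x^⊥` is needed: `(q, -p)` is orthogonal to `(q, p)`.
  have hiso : star q * q = star p * p := by
    have h1 : perp x.1 = x.1.map (mapJ A) := hx
    rw [hx1, perp_map_cayley, map_mapJ_map_cayley_pt] at h1
    have h2 := Submodule.map_injective_of_injective (cayley A).injective h1
    have h3 : (q, -p) ∈ perp (pt q p) := h2 ▸ mem_pt.2 ⟨1, by simp⟩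
    have h4 := h3 (q, p) (mem_pt.2 ⟨1, by simp⟩)
    simp only [mul_neg] at h4
    exact add_neg_eq_zero.1 h4
  have hsq : ∀ r t : A, star (r * t) * (r * t) = star t * (star r * r) * t := by
    intro r t
    simp only [star_mul, mul_assoc]
  -- If `q t = 0`, then `(p t)* (p t) = t* q* q t = 0`, so `p t = 0` as well and `t = 0`.
  have hq : IsUnit q := isUnit_of_mul_right_cancel_zero fun t ht =>
    hcancel t ht (hA _ (by rw [hsq, ← hiso, ← hsq, ht, mul_zero]))
  have hp : IsUnit p := isUnit_of_mul_right_cancel_zero fun t ht =>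
    hcancel t (hA _ (by rw [hsq, hiso, ← hsq, ht, mul_zero])) ht
  obtain ⟨q, rfl⟩ := hq
  obtain ⟨p, rfl⟩ := hp
  have hstar : star ((p : A) * ↑q⁻¹) * (p * ↑q⁻¹) = 1 := by
    rw [hsq, ← hiso, ← hsq, Units.mul_inv, star_one, one_mul]
  have hu : IsUnit ((p : A) * ↑q⁻¹) := (p * q⁻¹).isUnit
  refine ⟨p * ↑q⁻¹, Unitary.mem_iff.2 ⟨hstar, ?_⟩, Subtype.ext ?_⟩
  · obtain ⟨r, hr⟩ := hu
    rw [← hr] at hstar ⊢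
    rw [left_inv_eq_right_inv hstar r.mul_inv, Units.mul_inv]
  · rw [hx1, ← pt_mul_right q⁻¹.isUnit (q : A), Units.mul_inv]
    rfl

section FiniteDimensional

variable [FiniteDimensional ℂ A]

theorem hermitianLine_eq_image (hA : ∀ t : A, star t * t = 0 → t = 0) :
    hermitianLine A = affineChart (cayley A) '' unitary A :=
  Set.Subset.antisymm (fun _ hx => exists_unitary_of_mem_hermitianLine hA hx)
    (Set.image_subset_iff.2 fun _ hw => affineChart_cayley_mem_hermitianLine hw)

theorem hermitianLine'_eq_image (hA : ∀ t : A, star t * t = 0 → t = 0) :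
    hermitianLine' A = affineChart (cayley A) '' unitary A :=
  Set.Subset.antisymm (fun _ hx => exists_unitary_of_mem_hermitianLine hA hx.1)
    (Set.image_subset_iff.2 fun _ hw => affineChart_cayley_mem_hermitianLine' hw)

theorem realUnitaryUniverse_eq_image (hA : ∀ t : A, star t * t = 0 → t = 0) :
    realUnitaryUniverse A = affineChart (cayley A) '' unitary A :=
  Set.Subset.antisymm (fun _ hx => exists_unitary_of_mem_hermitianLine hA hx.1)
    (Set.image_subset_iff.2 fun _ hw => affineChart_cayley_mem_realUnitaryUniverse hw)

/-- The unitary group is homeomorphic to the real unitary universe, by the Cayley transform. -/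
def unitaryHomeomorph [TopologicalSpace A] [IsTopologicalRing A]
    (hA : ∀ t : A, star t * t = 0 → t = 0) (hU : IsOpen {a : A | IsUnit a})
    (hI : ContinuousOn Ring.inverse {a : A | IsUnit a}) :
    unitary A ≃ₜ realUnitaryUniverse A :=
  ((isOpenEmbedding_affineChart hU hI (cayley A)).isEmbedding.comp
      Topology.IsEmbedding.subtypeVal).toHomeomorph.trans
    (Homeomorph.setCongr (by
      rw [Set.range_comp, Subtype.range_coe, realUnitaryUniverse_eq_image hA]))

theorem unitaryHomeomorph_mul_inv_mul [TopologicalSpace A] [IsTopologicalRing A]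
    (hA : ∀ t : A, star t * t = 0 → t = 0) (hU : IsOpen {a : A | IsUnit a})
    (hI : ContinuousOn Ring.inverse {a : A | IsUnit a}) (u v w : unitary A) :
    (unitaryHomeomorph hA hU hI (u * v⁻¹ * w)).1.1 =
      unitaryProd (unitaryHomeomorph hA hU hI v) (unitaryHomeomorph hA hU hI u)
        (unitaryHomeomorph hA hU hI w) :=
  (torsorProd_map_pt_one (cayley A) (Unitary.toUnits u) (Unitary.toUnits v) (Unitary.toUnits w)
    northPole_eq southPole_eq rfl rfl rfl _ _).symm

/-- For every choice of an origin, the real unitary universe is isomorphic to the unitary group. -/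
theorem exists_homeomorph_unitary [TopologicalSpace A] [IsTopologicalRing A]
    (hA : ∀ t : A, star t * t = 0 → t = 0) (hU : IsOpen {a : A | IsUnit a})
    (hI : ContinuousOn Ring.inverse {a : A | IsUnit a}) (y : realUnitaryUniverse A) :
    ∃ Φ : realUnitaryUniverse A ≃ₜ unitary A, ∀ x z : realUnitaryUniverse A,
      (Φ.symm (Φ x * Φ z)).1.1 = unitaryProd y x z := by
  -- With `v` the unitary of `y`, right translation by `v⁻¹` moves the origin to `1`: `(u v⁻¹)(w
  -- v⁻¹) = (u v⁻¹ w) v⁻¹`.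
  refine ⟨(unitaryHomeomorph hA hU hI).symm.trans
    (Homeomorph.mulRight ((unitaryHomeomorph hA hU hI).symm y)⁻¹), fun x z => ?_⟩
  obtain ⟨v, rfl⟩ := (unitaryHomeomorph hA hU hI).surjective y
  obtain ⟨u, rfl⟩ := (unitaryHomeomorph hA hU hI).surjective x
  obtain ⟨w, rfl⟩ := (unitaryHomeomorph hA hU hI).surjective z
  rw [← unitaryHomeomorph_mul_inv_mul]
  simp [mul_assoc, Homeomorph.mulRight_symm]

end FiniteDimensional

end Star

end Cayley

/-! ### Connectedness of the unitary group in finite dimension -/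

section CStar

variable {A : Type*}

/-- By spectral mapping, spectral values are roots of the minimal polynomial. -/
theorem finite_spectrum_of_finiteDimensional [Ring A] [Algebra ℂ A] [FiniteDimensional ℂ A]
    (a : A) : (spectrum ℂ a).Finite := by
  nontriviality A
  refine ((minpoly ℂ a).rootSet_finite ℂ).subset fun z hz => ?_
  rw [Polynomial.mem_rootSet]
  refine ⟨minpoly.ne_zero (Algebra.IsIntegral.isIntegral a), ?_⟩
  have h := spectrum.subset_polynomial_aeval a (minpoly ℂ a) ⟨z, hz, rfl⟩
  rw [minpoly.aeval, spectrum.zero_eq] at h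
  simpa using h

variable [CStarAlgebra A]

open Complex selfAdjoint Unitary in
/-- A unitary element of a `C⋆`-algebra with finite spectrum is the exponential of its argument. -/
theorem expUnitary_argSelfAdjoint_of_finite {u : unitary A} (hu : (spectrum ℂ (u : A)).Finite) :
    expUnitary (argSelfAdjoint u) = u := by
  ext
  -- Finiteness makes the jump of `arg` on the negative axis harmless, so the functional calculus
  -- applies to `arg`.
  have : ContinuousOn arg (spectrum ℂ (u : A)) := hu.continuousOn _
  rw [expUnitary_coe, argSelfAdjoint_coe, ← CFC.exp_eq_normedSpace_exp (𝕜 := ℂ),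
    ← cfc_comp_smul .., ← cfc_comp' ..]
  conv_rhs => rw [← cfc_id' ℂ (u : A)]
  refine cfc_congr fun y hy ↦ ?_
  have hy₁ : ‖y‖ = 1 := spectrum.norm_eq_one_of_unitary u.2 hy
  have : I * y.arg = log y := Complex.ext (by simp [log_re, hy₁]) (by simp [log_im])
  simpa [← exp_eq_exp_ℂ, this] using exp_log (by rintro rfl; simp at hy₁)

theorem isConnected_unitary_of_finiteDimensional [FiniteDimensional ℂ A] :
    IsConnected (unitary A : Set A) := by
  have h : PathConnectedSpace (unitary A) := by
    have h1 : ∀ u : unitary A, Joined 1 u := fun u => by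
      rw [← expUnitary_argSelfAdjoint_of_finite (finite_spectrum_of_finiteDimensional (u : A))]
      exact selfAdjoint.joined_one_expUnitary _
    exact ⟨⟨1⟩, fun u v => (h1 u).symm.trans (h1 v)⟩
  exact isConnected_iff_connectedSpace.2 (inferInstanceAs (ConnectedSpace (unitary A)))

theorem realUnitaryUniverse_eq_connectedComponentIn [FiniteDimensional ℂ A] :
    ∃ x ∈ hermitianLine A, realUnitaryUniverse A = connectedComponentIn (hermitianLine A) x := by
  have hA : ∀ t : A, star t * t = 0 → t = 0 := fun t => CStarRing.star_mul_self_eq_zero_iff t |>.1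
  have hx := affineChart_cayley_mem_hermitianLine (one_mem (unitary A))
  refine ⟨_, hx, ?_⟩
  have hc : IsConnected (hermitianLine A) := by
    rw [hermitianLine_eq_image hA]
    exact isConnected_unitary_of_finiteDimensional.image _
      (continuous_affineChart (cayley A)).continuousOn
  rw [hc.isPreconnected.connectedComponentIn hx, realUnitaryUniverse_eq_image hA,
    hermitianLine_eq_image hA]

end CStar

/-! ### Units and inversion in matrix algebras -/

section Matrix

variable (n : ℕ)

open scoped ComplexOrder in
theorem eq_zero_of_star_mul_self_eq_zero_matrix (t : Matrix (Fin n) (Fin n) ℂ)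
    (ht : star t * t = 0) : t = 0 :=
  Matrix.conjTranspose_mul_self_eq_zero.1 ht

theorem isOpen_setOf_isUnit_matrix : IsOpen {a : Matrix (Fin n) (Fin n) ℂ | IsUnit a} := by
  simp only [Matrix.isUnit_iff_isUnit_det, isUnit_iff_ne_zero]
  exact isOpen_ne_fun (Continuous.matrix_det continuous_id) continuous_const

theorem continuousOn_ringInverse_matrix :
    ContinuousOn Ring.inverse {a : Matrix (Fin n) (Fin n) ℂ | IsUnit a} := by
  intro a ha
  have h : (Ring.inverse : Matrix (Fin n) (Fin n) ℂ → _) = Inv.inv :=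
    funext fun b => (Matrix.nonsing_inv_eq_ringInverse b).symm
  rw [h]
  refine (continuousAt_matrix_inv a ?_).continuousWithinAt
  rw [Ring.inverse_eq_inv']
  exact continuousAt_inv₀ ((Matrix.isUnit_iff_isUnit_det a).1 ha).ne_zero

end Matrix

end HermProj

end

/-- The product is a priori only a submodule. Equating it with the point `Φ.symm (Φ x * Φ z)`
expresses both closure of `ℛ_{N,S}` and multiplicativity of `Φ`. -/
theorem mainTheorem4 :
    (∀ (A : Type*) [CStarAlgebra A] [FiniteDimensional ℂ A],
      ∃ x ∈ HermProj.hermitianLine A,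
        HermProj.realUnitaryUniverse A = connectedComponentIn (HermProj.hermitianLine A) x) ∧
    (∀ n : ℕ,
      HermProj.hermitianLine (Matrix (Fin n) (Fin n) ℂ) =
          HermProj.hermitianLine' (Matrix (Fin n) (Fin n) ℂ) ∧
      HermProj.hermitianLine' (Matrix (Fin n) (Fin n) ℂ) =
          HermProj.realUnitaryUniverse (Matrix (Fin n) (Fin n) ℂ) ∧
      (HermProj.realUnitaryUniverse (Matrix (Fin n) (Fin n) ℂ)).Nonempty ∧
      ∀ y : HermProj.realUnitaryUniverse (Matrix (Fin n) (Fin n) ℂ),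
        ∃ Φ : HermProj.realUnitaryUniverse (Matrix (Fin n) (Fin n) ℂ) ≃ₜ
            Matrix.unitaryGroup (Fin n) ℂ,
          ∀ x z : HermProj.realUnitaryUniverse (Matrix (Fin n) (Fin n) ℂ),
            (Φ.symm (Φ x * Φ z)).1.1 = HermProj.unitaryProd y x z) := by
  refine ⟨fun A _ _ => HermProj.realUnitaryUniverse_eq_connectedComponentIn, fun n => ?_⟩
  have hA := HermProj.eq_zero_of_star_mul_self_eq_zero_matrix n
  refine ⟨?_, ?_, ?_, HermProj.exists_homeomorph_unitary hA (HermProj.isOpen_setOf_isUnit_matrix n)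
    (HermProj.continuousOn_ringInverse_matrix n)⟩
  · rw [HermProj.hermitianLine_eq_image hA, HermProj.hermitianLine'_eq_image hA]
  · rw [HermProj.hermitianLine'_eq_image hA, HermProj.realUnitaryUniverse_eq_image hA]
  · exact ⟨_, HermProj.affineChart_cayley_mem_realUnitaryUniverse (one_mem _)⟩
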